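/- Let $R$ be any ring (associative with $1$). Let $\mathsf{Mod}(R)$ be the category of right $R$-modules and $\mathsf{fp}(\mathsf{Mod}(R),\mathsf{Ab})$ the abelian category of finitely presented functors, i.e. of those functors $F:\mathsf{Mod}(R)\to\mathsf{Ab}$ for which there are modules $X,Y$ and a sequence of natural transformations $(Y,-)\to(X,-)\to F\to 0$ that is exact at every module. Let $(\mathsf{mod}(R^{op}),\mathsf{Ab})$ be the abelian category, with enough injectives, of additive functors from finitely presented left $R$-modules to abelian groups. Let $\mathsf{D}_L=L^0(\mathsf{Y}\circ \mathsf{ev}_R)$ be the zeroth left derived functor of the contravariant functor $$\mathsf{Y}\circ\mathsf{ev}_R:(\mathsf{mod}(R^{op}),\mathsf{Ab})\to\mathsf{fp}(\mathsf{Mod}(R),\mathsf{Ab}),\qquad G\mapsto (G(R),-),$$ where $G(R)$ is a right $R$-module through $x\cdot r=G(s\mapsto sr)(x)$. (If $0\to G\to I^0\to I^1$ is an injective copresentation, then $(I^1(R),-)\to(I^0(R),-)\to \mathsf{D}_L G\to 0$ is exact.) Then the contravariant functor $$\mathsf{D}_L:(\mathsf{mod}(R^{op}),\mathsf{Ab})\to\mathsf{fp}(\mathsf{Mod}(R),\mathsf{Ab})$$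 is fully faithful; that is, $(\mathsf{mod}(R^{op}),\mathsf{Ab})$ embeds contravariantly into $\mathsf{fp}(\mathsf{Mod}(R),\mathsf{Ab})$ via $\mathsf{D}_L$. -/

import Mathlib

open CategoryTheory CategoryTheory.Limits Opposite

universe u

noncomputable section

namespace AGJ

/-! ## Additive functors on a preadditive category form an abelian category -/

section AdditiveFunctors

variable (C : Type*) [Category C] [Preadditive C]

instance : (additiveFunctor C AddCommGrpCat.{u}).IsClosedUnderSubobjects where
  prop_of_mono {F G} i _ hG := by
    have : G.Additive := hG
    refine ⟨fun {X Y f g} => ?_⟩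
    have : Mono (i.app Y) := inferInstance
    rw [← cancel_mono (i.app Y)]
    simp

instance : (additiveFunctor C AddCommGrpCat.{u}).IsClosedUnderQuotients where
  prop_of_epi {F G} p _ hF := by
    have : F.Additive := hF
    refine ⟨fun {X Y f g} => ?_⟩
    have : Epi (p.app X) := inferInstance
    rw [← cancel_epi (p.app X)]
    simp [← NatTrans.naturality]

instance : (additiveFunctor C AddCommGrpCat.{u}).ContainsZero where
  exists_zero := ⟨(Functor.const C).obj (AddCommGrpCat.of PUnit),
    (Functor.isZero_iff _).2 fun _ =>
      AddCommGrpCat.isZero_of_subsingleton (AddCommGrpCat.of PUnit),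
    ⟨fun {_ _ _ _} => (AddCommGrpCat.isZero_of_subsingleton (AddCommGrpCat.of PUnit)).eq_of_src _ _⟩⟩

instance : (additiveFunctor C AddCommGrpCat.{u}).IsClosedUnderBinaryProducts where
  limitsOfShape_le := by
    rintro X ⟨p⟩
    have h (j : WalkingPair) : (p.diag.obj ⟨j⟩).Additive := p.prop_diag_obj _
    refine ⟨fun {A B f g} => ?_⟩
    have hl := isLimitOfPreserves ((evaluation C AddCommGrpCat.{u}).obj B) p.isLimit
    refine hl.hom_ext fun ⟨j⟩ => ?_
    have := h j
    change X.map (f + g) ≫ (p.π.app ⟨j⟩).app B = (X.map f + X.map g) ≫ (p.π.app ⟨j⟩).app B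
    simp [NatTrans.naturality]

instance : (additiveFunctor C AddCommGrpCat.{u}).IsClosedUnderFiniteProducts :=
  .mk'

instance : Abelian (C ⥤+ AddCommGrpCat.{u}) :=
  inferInstanceAs (Abelian (additiveFunctor C AddCommGrpCat.{u}).FullSubcategory)

end AdditiveFunctors

/-! ## Enough injectives -/

section Injectives

variable {C : Type*} [Category.{u} C] [Preadditive C]

/-- For families of objects `X i` of `C` and of abelian groups `A i`, the additive functor
`Y ↦ ∏ i, Hom(C(Y, X i), A i)`. -/
def coind {ι : Type u} (X : ι → C) (A : ι → AddCommGrpCat.{u}) : C ⥤+ AddCommGrpCat.{u} where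
  obj :=
    { obj Y := AddCommGrpCat.of (∀ i, (Y ⟶ X i) →+ A i)
      map {Y Z} f := AddCommGrpCat.ofHom
        { toFun := fun a i => (a i).comp (Preadditive.leftComp (X i) f)
          map_zero' := rfl
          map_add' := fun _ _ => rfl }
      map_id Y := by
        ext a i c
        change a i (𝟙 Y ≫ c) = a i c
        rw [Category.id_comp]
      map_comp f g := by
        ext a i c
        change a i ((f ≫ g) ≫ c) = a i (f ≫ g ≫ c)
        rw [Category.assoc] }
  property := by
    refine ⟨fun {Y Z f g} => ?_⟩
    ext a i c
    change a i ((f + g) ≫ c) = a i (f ≫ c) + a i (g ≫ c)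
    rw [Preadditive.add_comp, map_add]

/-- A family of maps `G (X i) ⟶ A i` induces a morphism from `G` to `coind X A`. -/
def toCoind {ι : Type u} {X : ι → C} {A : ι → AddCommGrpCat.{u}} (G : C ⥤+ AddCommGrpCat.{u})
    (φ : ∀ i, G.obj.obj (X i) ⟶ A i) : G ⟶ coind X A :=
  ObjectProperty.homMk
    { app Y := AddCommGrpCat.ofHom
        { toFun := fun y i =>
            { toFun := fun c => φ i (G.obj.map c y)
              map_zero' := by simp
              map_add' := by simp }
          map_zero' := by
            funext i
            ext c
            simp
          map_add' := fun _ _ => by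
            funext i
            ext c
            simp }
      naturality Y Z f := by
        ext y
        funext i
        ext c
        change φ i (G.obj.map c (G.obj.map f y)) = φ i (G.obj.map (f ≫ c) y)
        rw [G.obj.map_comp, ConcreteCategory.comp_apply] }

lemma mono_app {G G' : C ⥤+ AddCommGrpCat.{u}} (f : G ⟶ G') [Mono f] (Y : C) :
    Mono (f.hom.app Y) := by
  have := (additiveFunctor C AddCommGrpCat.{u}).preservesMonomorphisms_ι_of_isNormalEpiCategory
  have : Mono f.hom := inferInstanceAs (Mono ((additiveFunctor C AddCommGrpCat.{u}).ι.map f))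
  infer_instance

lemma injective_coind {ι : Type u} (X : ι → C) (A : ι → AddCommGrpCat.{u})
    (hA : ∀ i, Injective (A i)) : Injective (coind X A) where
  factors {G G'} g f _ := by
    let φ (i : ι) : G.obj.obj (X i) ⟶ A i := AddCommGrpCat.ofHom
      { toFun := fun y => (g.hom.app (X i) y : ∀ i, _ →+ A i) i (𝟙 (X i))
        map_zero' := by
          rw [map_zero]
          rfl
        map_add' := fun _ _ => by
          rw [map_add]
          rfl }
    have hm (i : ι) : Mono (f.hom.app (X i)) := mono_app f (X i)
    refine ⟨toCoind G' fun i => Injective.factorThru (φ i) (f.hom.app (X i)), ?_⟩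
    ext Y y
    funext i
    ext c
    have h₁ : G'.obj.map c (f.hom.app Y y) = f.hom.app (X i) (G.obj.map c y) :=
      (NatTrans.naturality_apply f.hom c y).symm
    have h₂ : Injective.factorThru (φ i) (f.hom.app (X i)) (f.hom.app (X i) (G.obj.map c y)) =
        φ i (G.obj.map c y) :=
      ConcreteCategory.congr_hom (Injective.comp_factorThru (φ i) (f.hom.app (X i))) _
    have h₃ : g.hom.app (X i) (G.obj.map c y) = (coind X A).obj.map c (g.hom.app Y y) :=
      NatTrans.naturality_apply g.hom c y
    have h₄ : φ i (G.obj.map c y) = (g.hom.app Y y : ∀ i, _ →+ A i) i (c ≫ 𝟙 (X i)) :=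
      DFunLike.congr_fun (congrFun h₃ i) (𝟙 (X i))
    rw [Category.comp_id] at h₄
    exact (congrArg _ h₁).trans (h₂.trans h₄)

/-- If the objects of `C` are classified up to isomorphism by a small family, then the category of
additive functors from `C` to abelian groups has enough injectives. -/
lemma enoughInjectives_of_family {ι : Type u} (X : ι → C)
    (hX : ∀ Y : C, ∃ i, Nonempty (Y ≅ X i)) : EnoughInjectives (C ⥤+ AddCommGrpCat.{u}) where
  presentation G := by
    let φ (i : ι) : G.obj.obj (X i) ⟶ Injective.under (G.obj.obj (X i)) := Injective.ι _
    refine ⟨⟨coind X fun i => Injective.under (G.obj.obj (X i)),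
      injective_coind _ _ fun i => inferInstance, toCoind G φ, ?_⟩⟩
    have (Y : C) : Mono ((toCoind G φ).hom.app Y) := by
      rw [AddCommGrpCat.mono_iff_injective, injective_iff_map_eq_zero]
      intro y hy
      obtain ⟨i, ⟨e⟩⟩ := hX Y
      have h : φ i (G.obj.map e.hom y) = 0 :=
        DFunLike.congr_fun (congrFun hy i) e.hom
      have h' : G.obj.map e.hom y = 0 :=
        (AddCommGrpCat.mono_iff_injective (φ i)).1 inferInstance (h.trans (map_zero _).symm)
      have := congrArg (G.obj.map e.inv) h'
      rwa [map_zero, ← ConcreteCategory.comp_apply, ← G.obj.map_comp, e.hom_inv_id,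
        G.obj.map_id] at this
    have : Mono (toCoind G φ).hom := NatTrans.mono_of_mono_app _
    exact (additiveFunctor C AddCommGrpCat.{u}).ι.mono_of_mono_map this

end Injectives

/-! ## Finitely presented functors -/

lemma map_comp_apply' {C : Type*} [Category.{u} C] (F : C ⥤ AddCommGrpCat.{u}) {X Y Z : C}
    (f : X ⟶ Y) (g : Y ⟶ Z) (x : F.obj X) : F.map g (F.map f x) = F.map (f ≫ g) x :=
  (ConcreteCategory.congr_hom (F.map_comp f g) x).symm

section FinitelyPresented

variable {C : Type*} [Category.{u} C] [Abelian C]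

variable (C) in
/-- A functor `F` on `C` is finitely presented if there is a sequence
`(Y, -) ⟶ (X, -) ⟶ F ⟶ 0` of natural transformations which is exact at every object. (Every
natural transformation `(Y, -) ⟶ (X, -)` is induced by a unique morphism `X ⟶ Y`.) Such a functor
is automatically additive. -/
def isFinitelyPresented : ObjectProperty (C ⥤ AddCommGrpCat.{u}) := fun F =>
  ∃ (X Y : C) (f : preadditiveCoyoneda.obj (op Y) ⟶ preadditiveCoyoneda.obj (op X))
    (p : preadditiveCoyoneda.obj (op X) ⟶ F),
    ∀ A : C, Function.Exact (f.app A) (p.app A) ∧ Function.Surjective (p.app A)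

variable (C) in
/-- The category `fp(C, Ab)` of finitely presented functors and natural transformations. -/
abbrev FpFunctor := (isFinitelyPresented C).FullSubcategory

lemma isFinitelyPresented_iff (F : C ⥤ AddCommGrpCat.{u}) :
    isFinitelyPresented C F ↔ F.Additive ∧ ∃ (X Y : C) (f : X ⟶ Y) (x : F.obj X),
      (∀ (A : C) (y : F.obj A), ∃ g : X ⟶ A, F.map g x = y) ∧
      ∀ (A : C) (g : X ⟶ A), F.map g x = 0 ↔ ∃ h : Y ⟶ A, f ≫ h = g := by
  constructor
  · rintro ⟨X, Y, f, p, h⟩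
    obtain ⟨f, rfl⟩ := preadditiveCoyoneda.map_surjective f
    have key {A B : C} (g : X ⟶ A) (k : A ⟶ B) : F.map k (p.app A g) = p.app B (g ≫ k :) :=
      (NatTrans.naturality_apply p k g).symm
    have key' {A : C} (g : X ⟶ A) : F.map g (p.app X (𝟙 X)) = p.app A g :=
      (key (𝟙 X) g).trans (congrArg (p.app A) (Category.id_comp g))
    refine ⟨⟨fun {A B a b} => ?_⟩, X, Y, f.unop, p.app X (𝟙 X), fun A y => ?_, fun A g => ?_⟩
    · ext y
      obtain ⟨g, rfl⟩ := (h A).2 y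
      have h₁ : p.app B ((g : X ⟶ A) ≫ (a + b) :) =
          p.app B ((g : X ⟶ A) ≫ a :) + p.app B ((g : X ⟶ A) ≫ b :) := by
        refine Eq.trans ?_ (map_add (p.app B).hom _ _)
        exact congrArg (p.app B) (Preadditive.comp_add (C := C) _ _ _ g a b)
      exact (key g (a + b)).trans (h₁.trans (congrArg₂ (· + ·) (key g a).symm (key g b).symm))
    · obtain ⟨g, rfl⟩ := (h A).2 y
      exact ⟨g, key' g⟩
    · rw [key']
      exact (h A).1 g
  · rintro ⟨_, X, Y, f, x, h₁, h₂⟩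
    refine ⟨X, Y, preadditiveCoyoneda.map f.op,
      { app A := AddCommGrpCat.ofHom (X := (X ⟶ A)) (Y := F.obj A)
          { toFun := fun g => F.map g x
            map_zero' := by simp
            map_add' := by simp }
        naturality A B k := by
          ext g
          change F.map ((g : X ⟶ A) ≫ k) x = F.map k (F.map (g : X ⟶ A) x)
          exact ConcreteCategory.congr_hom (F.map_comp (X := X) g k) x },
      fun A => ⟨fun g => h₂ A g, fun y => h₁ A y⟩⟩

instance : (isFinitelyPresented C).ContainsZero where
  exists_zero := by
    have h0 : IsZero (AddCommGrpCat.of PUnit.{u + 1}) :=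
      AddCommGrpCat.isZero_of_subsingleton (AddCommGrpCat.of PUnit)
    refine ⟨(Functor.const C).obj (AddCommGrpCat.of PUnit), (Functor.isZero_iff _).2 fun _ => h0,
      (isFinitelyPresented_iff _).2 ⟨⟨fun {_ _ _ _} => h0.eq_of_src _ _⟩, ?_⟩⟩
    obtain ⟨Z, hZ⟩ := HasZeroObject.zero (C := C)
    exact ⟨Z, Z, 𝟙 Z, PUnit.unit, fun A y => ⟨0, rfl⟩,
      fun A g => ⟨fun _ => ⟨g, Category.id_comp g⟩, fun _ => rfl⟩⟩

instance : (isFinitelyPresented C).IsClosedUnderCokernels where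
  cokernels_le := by
    rintro _ ⟨φ, c, hc, hF, hG⟩
    rename_i F G
    rw [isFinitelyPresented_iff] at hF hG ⊢
    obtain ⟨_, X, Y, f, x, hx, -⟩ := hF
    obtain ⟨_, X', Y', f', x', hx', hf'⟩ := hG
    have := Cofork.IsColimit.epi hc
    have hs (A : C) : Function.Surjective (c.π.app A) :=
      (AddCommGrpCat.epi_iff_surjective _).1 inferInstance
    have he (A : C) (y : G.obj A) : c.π.app A y = 0 ↔ ∃ z, φ.app A z = y := by
      let S := ShortComplex.mk φ c.π c.condition
      have hS : S.Exact := S.exact_of_g_is_cokernel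
        (IsColimit.ofIsoColimit hc (Cofork.ext (Iso.refl _)))
      have := (ShortComplex.ab_exact_iff_function_exact _).1
        (hS.map ((evaluation C AddCommGrpCat.{u}).obj A))
      exact this y
    refine ⟨⟨fun {A B a b} => ?_⟩, ?_⟩
    · have : Epi (c.π.app A) := inferInstance
      rw [← cancel_epi (c.π.app A)]
      simp only [Preadditive.comp_add]
      erw [← c.π.naturality, ← c.π.naturality, ← c.π.naturality]
      rw [Functor.map_add, Preadditive.add_comp]
    obtain ⟨h, hh⟩ := hx' X (φ.app X x)
    refine ⟨X', Y' ⊞ X, biprod.lift f' h, c.π.app X' x', fun A y => ?_, fun A g => ?_⟩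
    · obtain ⟨z, rfl⟩ := hs A y
      obtain ⟨g, rfl⟩ := hx' A z
      exact ⟨g, (NatTrans.naturality_apply c.π g x').symm⟩
    · have h₁ := NatTrans.naturality_apply c.π g x'
      refine Iff.trans (Eq.congr h₁.symm rfl) ((he A _).trans ⟨?_, ?_⟩)
      · rintro ⟨z, hz⟩
        obtain ⟨k, rfl⟩ := hx A z
        have h₂ := NatTrans.naturality_apply φ k x
        rw [← hh, map_comp_apply'] at h₂
        have h₃ : G.map (g - h ≫ k) x' = 0 := by
          rw [Functor.map_sub]
          change G.map g x' - G.map (h ≫ k) x' = 0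
          rw [← hz, ← h₂, sub_self]
        obtain ⟨l, hl⟩ := (hf' _ _).1 h₃
        exact ⟨biprod.desc l k, by simp [hl]⟩
      · rintro ⟨l, rfl⟩
        refine ⟨F.map (biprod.inr ≫ l) x, ?_⟩
        rw [NatTrans.naturality_apply, ← hh, map_comp_apply']
        have h₃ := (hf' _ _).2 ⟨biprod.inl ≫ l, rfl⟩
        have h₄ : biprod.lift f' h ≫ l = f' ≫ biprod.inl ≫ l + h ≫ biprod.inr ≫ l := by
          rw [biprod.lift_eq]
          simp
        rw [h₄, Functor.map_add]
        change _ = G.map (f' ≫ biprod.inl ≫ l) x' + G.map (h ≫ biprod.inr ≫ l) x'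
        rw [h₃, zero_add]

instance : (isFinitelyPresented C).IsClosedUnderKernels where
  kernels_le := by
    rintro _ ⟨φ, c, hc, hF, hG⟩
    rename_i F G
    rw [isFinitelyPresented_iff] at hF hG ⊢
    obtain ⟨_, X, Y, f, x, hx, hf⟩ := hF
    obtain ⟨_, X', Y', f', x', hx', hf'⟩ := hG
    have := Fork.IsLimit.mono hc
    have hm (A : C) : Mono (c.ι.app A) := inferInstance
    have hi (A : C) : Function.Injective (c.ι.app A) :=
      (AddCommGrpCat.mono_iff_injective _).1 (hm A)
    have he (A : C) (y : F.obj A) : φ.app A y = 0 ↔ ∃ z, c.ι.app A z = y := by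
      let S := ShortComplex.mk c.ι φ c.condition
      have hS : S.Exact := S.exact_of_f_is_kernel
        (IsLimit.ofIsoLimit hc (Fork.ext (Iso.refl _)))
      have := (ShortComplex.ab_exact_iff_function_exact _).1
        (hS.map ((evaluation C AddCommGrpCat.{u}).obj A))
      exact this y
    refine ⟨⟨fun {A B a b} => ?_⟩, ?_⟩
    · rw [← cancel_mono (c.ι.app B)]
      simp only [Preadditive.add_comp]
      erw [c.ι.naturality, c.ι.naturality, c.ι.naturality]
      rw [Functor.map_add, Preadditive.comp_add]
    obtain ⟨h, hh⟩ := hx' X (φ.app X x)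
    have hφ {A : C} (k : X ⟶ A) : φ.app A (F.map k x) = G.map (h ≫ k) x' := by
      rw [NatTrans.naturality_apply, ← hh, map_comp_apply']
    have h₀ : φ.app _ (F.map (pushout.inl h f') x) = 0 := by
      rw [hφ, pushout.condition, hf']
      exact ⟨_, rfl⟩
    obtain ⟨z, hz⟩ := (he _ _).1 h₀
    have hz' {A : C} (g : pushout h f' ⟶ A) :
        c.ι.app A (c.pt.map g z) =
          F.map (pushout.inl h f' ≫ g) x := by
      refine (NatTrans.naturality_apply c.ι g z).trans ?_
      refine (congrArg (F.map g) hz).trans ?_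
      exact map_comp_apply' F _ _ x
    refine ⟨pushout h f', pushout (pushout.inl h f') f, pushout.inl _ _, z,
      fun A y => ?_, fun A g => ?_⟩
    · obtain ⟨k, hk⟩ := hx A (c.ι.app A y)
      have h₁ : φ.app A (c.ι.app A y) = 0 := (he A _).2 ⟨y, rfl⟩
      rw [← hk, hφ, hf'] at h₁
      obtain ⟨l, hl⟩ := h₁
      refine ⟨pushout.desc k l hl.symm, hi A ?_⟩
      refine (hz' _).trans ?_
      rw [pushout.inl_desc, hk]
    · rw [← (hi A).eq_iff, map_zero]
      refine Iff.trans (Eq.congr (hz' g) rfl) ((hf _ _).trans ⟨?_, ?_⟩)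
      · rintro ⟨l, hl⟩
        exact ⟨pushout.desc g l hl.symm, pushout.inl_desc _ _ _⟩
      · rintro ⟨l, rfl⟩
        exact ⟨pushout.inr _ _ ≫ l, by rw [← pushout.condition_assoc]⟩

instance : (isFinitelyPresented C).IsClosedUnderFiniteProducts where
  isClosedUnderLimitsOfShape J _ := ⟨by
    rintro T ⟨p⟩
    have hp (j : J) := (isFinitelyPresented_iff _).1 (p.prop_diag_obj ⟨j⟩)
    choose hadd X Y f x hx hf using hp
    let π (j : J) : T ⟶ p.diag.obj ⟨j⟩ := p.π.app ⟨j⟩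
    have hl (A : C) := isLimitOfPreserves
      ((evaluation C AddCommGrpCat.{u}).obj A ⋙ forget AddCommGrpCat.{u}) p.isLimit
    have hinj (A : C) (s t : T.obj A) (h : ∀ j, (π j).app A s = (π j).app A t) : s = t :=
      (Types.isLimitEquivSections (hl A)).injective (Subtype.ext (funext fun ⟨j⟩ => h j))
    have hsurj (A : C) (a : ∀ j, (p.diag.obj ⟨j⟩).obj A) : ∃ s, ∀ j, (π j).app A s = a j := by
      obtain ⟨s, hs⟩ := (Types.isLimitEquivSections (hl A)).surjective
        ⟨fun ⟨j⟩ => a j, by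
          rintro ⟨j⟩ ⟨j'⟩ ⟨⟨h⟩⟩
          obtain rfl : j = j' := h
          exact ConcreteCategory.congr_hom
            (NatTrans.congr_app (p.diag.map_id ⟨j⟩) A) (a j)⟩
      exact ⟨s, fun j => congrFun (congrArg Subtype.val hs) ⟨j⟩⟩
    have : HasFiniteBiproducts C := Abelian.hasFiniteBiproducts
    refine (isFinitelyPresented_iff _).2 ⟨⟨fun {A B a b} => ?_⟩, ?_⟩
    · ext s
      refine hinj _ _ _ fun j => ?_
      have h₁ := NatTrans.naturality_apply (π j) (a + b) s
      have h₂ := NatTrans.naturality_apply (π j) a s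
      have h₃ := NatTrans.naturality_apply (π j) b s
      refine h₁.trans ?_
      rw [Functor.map_add]
      refine (congrArg₂ (· + ·) h₂.symm h₃.symm).trans (map_add ((π j).app B).hom _ _).symm
    cases nonempty_fintype J
    obtain ⟨s, hs⟩ := hsurj (⨁ X) fun j => (p.diag.obj ⟨j⟩).map (biproduct.ι X j) (x j)
    have hs' {A : C} (g : ⨁ X ⟶ A) (j : J) :
        (π j).app A (T.map g s) = (p.diag.obj ⟨j⟩).map (biproduct.ι X j ≫ g) (x j) := by
      rw [NatTrans.naturality_apply, hs, map_comp_apply']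
    refine ⟨⨁ X, ⨁ Y, biproduct.map f, s, fun A y => ?_, fun A g => ?_⟩
    · choose g hg using fun j => hx j A ((π j).app A y)
      refine ⟨biproduct.desc g, hinj _ _ _ fun j => ?_⟩
      rw [hs', biproduct.ι_desc, hg]
    · have h₁ : T.map g s = 0 ↔ ∀ j, ∃ h, f j ≫ h = biproduct.ι X j ≫ g := by
        simp only [← hf, ← hs']
        refine ⟨fun h j => by rw [h, map_zero], fun h => hinj _ _ _ fun j => ?_⟩
        rw [h, map_zero]
      rw [h₁]
      refine ⟨fun h => ?_, ?_⟩
      · choose k hk using h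
        exact ⟨biproduct.desc k, by ext j; simp [hk]⟩
      · rintro ⟨h, rfl⟩ j
        exact ⟨biproduct.ι Y j ≫ h, by simp⟩⟩

variable (C) in
instance : Abelian (FpFunctor C) := inferInstance

variable (C) in
/-- The contravariant Yoneda functor `X ↦ (X, -)` with values in finitely presented functors. -/
def yonedaFp : Cᵒᵖ ⥤ FpFunctor C :=
  (isFinitelyPresented C).lift preadditiveCoyoneda fun X =>
    ⟨X.unop, X.unop, 0, 𝟙 _, fun _ => ⟨fun _ => ⟨fun h => ⟨0, (map_zero _).trans h.symm⟩,
      fun ⟨_, h⟩ => h.symm⟩, fun g => ⟨g, rfl⟩⟩⟩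

instance : (yonedaFp C).Additive where
  map_add {X Y f g} := by
    ext A h
    exact Preadditive.add_comp _ _ _ f.unop g.unop h

end FinitelyPresented

/-! ## The functor `D_L` -/

section DL

variable (R : Type u) [Ring R]

/-- The property of a left `R`-module of being finitely presented. -/
def isFpModule : ObjectProperty (ModuleCat.{u} R) := fun M => Module.FinitePresentation R M

/-- `mod(Rᵒᵖ)`: the category of finitely presented left `R`-modules. -/
abbrev FpMod := (isFpModule R).FullSubcategory

/-- `Mod(R)`: the category of right `R`-modules. -/
abbrev RMod := ModuleCat.{u} Rᵐᵒᵖ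

instance : EnoughInjectives (FpMod R ⥤+ AddCommGrpCat.{u}) := by
  let ι : Type u := Σ n : ℕ, {K : Submodule R (Fin n → R) // K.FG}
  have hι (i : ι) : Module.FinitePresentation R ((Fin i.1 → R) ⧸ i.2.1) :=
    Module.finitePresentation_of_free_of_surjective i.2.1.mkQ i.2.1.mkQ_surjective
      (by rw [Submodule.ker_mkQ]; exact i.2.2)
  refine enoughInjectives_of_family (fun i : ι => ⟨ModuleCat.of R ((Fin i.1 → R) ⧸ i.2.1), hι i⟩)
    fun Y => ?_
  have : Module.FinitePresentation R Y.obj := Y.property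
  obtain ⟨n, K, e, hK⟩ := Module.FinitePresentation.exists_fin R Y.obj
  exact ⟨⟨n, K, hK⟩, ⟨(isFpModule R).isoMk e.toModuleIso⟩⟩

/-- `R` as a finitely presented left module over itself. -/
def regular : FpMod R where
  obj := ModuleCat.of R R
  property := inferInstanceAs (Module.FinitePresentation R R)

/-- The ring homomorphism from `Rᵐᵒᵖ` to the endomorphisms of the left module `R` which sends `r`
to right multiplication by `r`. -/
def rightMul : Rᵐᵒᵖ →+* End (regular R) where
  toFun r := (isFpModule R).homMk (ModuleCat.ofHom (LinearMap.toSpanSingleton R R r.unop))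
  map_one' := by
    refine ObjectProperty.hom_ext _ (ModuleCat.hom_ext (LinearMap.ext fun (x : R) => ?_))
    exact mul_one x
  map_mul' r s := by
    refine ObjectProperty.hom_ext _ (ModuleCat.hom_ext (LinearMap.ext fun (x : R) => ?_))
    exact (mul_assoc x s.unop r.unop).symm
  map_zero' := by
    refine ObjectProperty.hom_ext _ (ModuleCat.hom_ext (LinearMap.ext fun (x : R) => ?_))
    exact mul_zero x
  map_add' r s := by
    refine ObjectProperty.hom_ext _ (ModuleCat.hom_ext (LinearMap.ext fun (x : R) => ?_))
    exact mul_add x r.unop s.unop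

variable {R} in
/-- The right `R`-module structure on `G(R)`: the element `r` of `R` acts on `G(R)` through
`G(x ↦ x r)`. -/
def evAction (G : FpMod R ⥤+ AddCommGrpCat.{u}) : Rᵐᵒᵖ →+* End (G.obj.obj (regular R)) where
  toFun r := G.obj.map (rightMul R r)
  map_one' := by
    rw [map_one]
    exact G.obj.map_id _
  map_mul' r s := by
    rw [map_mul]
    exact G.obj.map_comp _ _
  map_zero' := by
    rw [map_zero]
    exact G.obj.map_zero _ _
  map_add' r s := by
    rw [map_add]
    exact G.obj.map_add

/-- Evaluation at the ring, `ev_R : (mod(Rᵒᵖ), Ab) ⥤ Mod(R)`, `G ↦ G(R)`. -/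
def evR : (FpMod R ⥤+ AddCommGrpCat.{u}) ⥤ RMod R where
  obj G := ModuleCat.mkOfSMul (evAction G)
  map α := ModuleCat.ofHom
    { toFun := fun x => α.hom.app (regular R) x
      map_add' := fun x y => map_add (α.hom.app (regular R)).hom x y
      map_smul' := fun r x => NatTrans.naturality_apply α.hom (rightMul R r) x }
  map_id _ := rfl
  map_comp _ _ := rfl

instance : (evR R).Additive where
  map_add := rfl

/-- The composition `Y ∘ ev_R`, a contravariant functor `G ↦ (G(R), -)` from `(mod(Rᵒᵖ), Ab)` to
`fp(Mod(R), Ab)`. -/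
def yonedaEv : (FpMod R ⥤+ AddCommGrpCat.{u})ᵒᵖ ⥤ FpFunctor (RMod R) :=
  (evR R).op ⋙ yonedaFp (RMod R)

instance : (yonedaEv R).Additive :=
  inferInstanceAs ((evR R).op ⋙ yonedaFp (RMod R)).Additive

/-- `D_L`, the zeroth left derived functor of the contravariant functor `Y ∘ ev_R`. As the source
is an opposite category, the projective resolutions which compute the left derived functor are
the injective resolutions `0 ⟶ G ⟶ I⁰ ⟶ I¹ ⟶ ⋯` in `(mod(Rᵒᵖ), Ab)`, so that `D_L(G)` is the
cokernel of `(I¹(R), -) ⟶ (I⁰(R), -)`. -/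
def DL : (FpMod R ⥤+ AddCommGrpCat.{u})ᵒᵖ ⥤ FpFunctor (RMod R) :=
  (yonedaEv R).leftDerived 0

end DL

end AGJ

end

noncomputable section

namespace AGJ

/-! ## The zeroth left derived functor as a cokernel -/

section LeftDerivedZero

variable {C D : Type*} [Category* C] [Category* D] [Abelian C] [HasProjectiveResolutions C]
  [Abelian D] (F : C ⥤ D) [F.Additive]

/-! The argument separates a general principle from a computation with modules. If `F` is additive,
sends projectives to projectives and is fully faithful on them, then `L₀F` is fully faithful
(`full_leftDerived_zero`, `faithful_leftDerived_zero`). Indeed `F(P₁) ⟶ F(P₀) ⟶ L₀F(X) ⟶ 0` is a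
projective presentation, so morphisms on both sides are morphisms of presentations modulo those
factoring through the differential, and `F` matches the two descriptions.

Here `F` is `Y ∘ ev_R`, and the projectives of the opposite category are the injective functors.
Representables are projective by Yoneda, and the Yoneda functor is fully faithful, so it remains to
see that `ev_R` is fully faithful on injectives. For `I` injective, `Hom(-, I)` is exact; applied to
`0 ⟶ (M,-) ⟶ (X,-) ⟶ (W,-)` it shows that `I` preserves each presentation `W ⟶ X ⟶ M ⟶ 0`
(`exists_map_eq_of_injective`). So `I` is in effect `I(R) ⊗ -`: `I(M)` is generated by the images of
`I(R)` under the maps `R ⟶ M`, with relations that every additive functor respects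
(`sumMap_surjective`, `sumMap_mapRange_eq_zero`). -/

/-- The zeroth left derived functor of `F` at `X` is computed by the degree `0` opcycles of `F(P)`,
for a projective resolution `P` of `X`. -/
def opcyclesIsoLeftDerivedZero {X : C} (P : ProjectiveResolution X) :
    HomologicalComplex.opcycles ((F.mapHomologicalComplex _).obj P.complex) 0 ≅
      (F.leftDerived 0).obj X :=
  (ChainComplex.isoHomologyι₀ _).symm ≪≫ (P.isoLeftDerivedObj F 0).symm

lemma opcyclesIsoLeftDerivedZero_naturality {X Y : C} (f : X ⟶ Y) (P : ProjectiveResolution X)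
    (Q : ProjectiveResolution Y) (φ : P.complex ⟶ Q.complex)
    (comm : φ.f 0 ≫ Q.π.f 0 = P.π.f 0 ≫ f) :
    (opcyclesIsoLeftDerivedZero F P).hom ≫ (F.leftDerived 0).map f =
      HomologicalComplex.opcyclesMap ((F.mapHomologicalComplex _).map φ) 0 ≫
        (opcyclesIsoLeftDerivedZero F Q).hom := by
  have h₁ := P.isoLeftDerivedObj_inv_naturality f Q φ comm F 0
  have h₂ := ChainComplex.isoHomologyι₀_inv_naturality ((F.mapHomologicalComplex _).map φ)
  refine (Category.assoc _ _ _).trans ((congrArg (_ ≫ ·) h₁).trans ?_)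
  refine (Category.assoc _ _ _).symm.trans ((congrArg (· ≫ _) h₂).trans ?_)
  exact Category.assoc _ _ _

/-- For a projective resolution `P` of `X`, the canonical morphism from `F(P₀)` to the zeroth left
derived functor of `F` at `X`. -/
def toLeftDerivedZero {X : C} (P : ProjectiveResolution X) :
    F.obj (P.complex.X 0) ⟶ (F.leftDerived 0).obj X :=
  HomologicalComplex.pOpcycles ((F.mapHomologicalComplex _).obj P.complex) 0 ≫
    (opcyclesIsoLeftDerivedZero F P).hom

instance {X : C} (P : ProjectiveResolution X) : Epi (toLeftDerivedZero F P) :=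
  inferInstanceAs (Epi (HomologicalComplex.pOpcycles
    ((F.mapHomologicalComplex _).obj P.complex) 0 ≫ (opcyclesIsoLeftDerivedZero F P).hom))

lemma map_d_toLeftDerivedZero {X : C} (P : ProjectiveResolution X) :
    F.map (P.complex.d 1 0) ≫ toLeftDerivedZero F P = 0 := by
  have := HomologicalComplex.d_pOpcycles ((F.mapHomologicalComplex _).obj P.complex) 1 0
  exact (Category.assoc _ _ _).symm.trans ((congrArg (· ≫ _) this).trans zero_comp)

/-- Opcycles in degree `0` are the cokernel of the differential out of degree `1`. This presentation
is all that is used below about the derived functor on objects. -/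
lemma exact_toLeftDerivedZero {X : C} (P : ProjectiveResolution X) :
    (ShortComplex.mk _ _ (map_d_toLeftDerivedZero F P)).Exact := by
  let K := (F.mapHomologicalComplex (ComplexShape.down ℕ)).obj P.complex
  have h : (ShortComplex.mk _ _ (K.d_pOpcycles 1 0)).Exact :=
    ShortComplex.exact_of_g_is_cokernel _ (K.opcyclesIsCokernel 1 0 (by simp))
  refine ShortComplex.exact_of_iso (S₁ := ShortComplex.mk _ _ (K.d_pOpcycles 1 0))
    (ShortComplex.isoMk (Iso.refl _) (Iso.refl _) (opcyclesIsoLeftDerivedZero F P) ?_ ?_) h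
  · exact (Category.id_comp _).trans (Category.comp_id _).symm
  · exact Category.id_comp _

lemma toLeftDerivedZero_naturality {X Y : C} (f : X ⟶ Y) (P : ProjectiveResolution X)
    (Q : ProjectiveResolution Y) (φ : P.complex ⟶ Q.complex)
    (comm : φ.f 0 ≫ Q.π.f 0 = P.π.f 0 ≫ f) :
    toLeftDerivedZero F P ≫ (F.leftDerived 0).map f =
      F.map (φ.f 0) ≫ toLeftDerivedZero F Q := by
  have h₁ := opcyclesIsoLeftDerivedZero_naturality F f P Q φ comm
  have h₂ := HomologicalComplex.p_opcyclesMap ((F.mapHomologicalComplex _).map φ) 0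
  refine (Category.assoc _ _ _).trans ((congrArg (_ ≫ ·) h₁).trans ?_)
  refine (Category.assoc _ _ _).symm.trans ((congrArg (· ≫ _) h₂).trans ?_)
  exact Category.assoc _ _ _

variable (hF : ∀ (P Q : C) [Projective P] [Projective Q],
    Function.Bijective (F.map : (P ⟶ Q) → (F.obj P ⟶ F.obj Q)))
  (hproj : ∀ (P : C) [Projective P], Projective (F.obj P))

include hF hproj

/-- A morphism `a : P ⟶ Q₀` from a projective object which induces zero on `L₀F` factors through
the differential of the resolution `Q`. -/
lemma factors_of_map_comp_toLeftDerivedZero_eq_zero {Y : C} (Q : ProjectiveResolution Y) {P : C}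
    [Projective P] (a : P ⟶ Q.complex.X 0) (ha : F.map a ≫ toLeftDerivedZero F Q = 0) :
    ∃ s : P ⟶ Q.complex.X 1, s ≫ Q.complex.d 1 0 = a := by
  have := hproj P
  -- Projectivity of `F(P)` lifts `F(a)` to `F(Q₁)`. Fullness on projectives writes the lift as
  -- `F(s)`, and faithfulness brings the equation back to the source category.
  obtain ⟨s, hs⟩ := (hF P (Q.complex.X 1)).2
    ((exact_toLeftDerivedZero F Q).liftFromProjective (F.map a) ha)
  refine ⟨s, (hF _ _).1 ?_⟩
  rw [F.map_comp, hs]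
  exact (exact_toLeftDerivedZero F Q).liftFromProjective_comp (F.map a) ha

/-- If an additive functor `F` preserves projective objects and is bijective on morphisms between
them, then its zeroth left derived functor is faithful. -/
lemma faithful_leftDerived_zero : (F.leftDerived 0).Faithful := by
  refine ⟨fun {X Y f g} hfg => ?_⟩
  let P := projectiveResolution X
  let Q := projectiveResolution Y
  let φ := ProjectiveResolution.lift f P Q
  let ψ := ProjectiveResolution.lift g P Q
  have hφ : φ.f 0 ≫ Q.π.f 0 = P.π.f 0 ≫ f := ProjectiveResolution.lift_commutes_zero _ _ _
  have hψ : ψ.f 0 ≫ Q.π.f 0 = P.π.f 0 ≫ g := ProjectiveResolution.lift_commutes_zero _ _ _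
  -- Both lifts induce the same map on `L₀F`, so their difference factors through the differential
  -- of `Q`, which dies in `Y`.
  have h : F.map (φ.f 0 - ψ.f 0) ≫ toLeftDerivedZero F Q = 0 := by
    rw [F.map_sub, Preadditive.sub_comp, ← toLeftDerivedZero_naturality F f P Q φ hφ,
      ← toLeftDerivedZero_naturality F g P Q ψ hψ, hfg, sub_self]
  obtain ⟨s, hs⟩ := factors_of_map_comp_toLeftDerivedZero_eq_zero F hF hproj Q _ h
  have h0 : P.π.f 0 ≫ f = P.π.f 0 ≫ g := by
    refine hφ.symm.trans (Eq.trans ?_ hψ)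
    rw [← sub_eq_zero, ← Preadditive.sub_comp, ← hs, Category.assoc, Q.complex_d_comp_π_f_zero,
      comp_zero]
  exact (cancel_epi (P.π.f 0)).1 h0

/-- If an additive functor `F` preserves projective objects and is bijective on morphisms between
them, then its zeroth left derived functor is full. -/
lemma full_leftDerived_zero : (F.leftDerived 0).Full := by
  refine ⟨fun {X Y} g => ?_⟩
  let P := projectiveResolution X
  let Q := projectiveResolution Y
  have := hproj (P.complex.X 0)
  -- Lift `g` to a map `F(P₀) ⟶ F(Q₀)`; by fullness on projectives it comes from some `a`.
  obtain ⟨a, ha⟩ := (hF (P.complex.X 0) (Q.complex.X 0)).2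
    (Projective.factorThru (toLeftDerivedZero F P ≫ g) (toLeftDerivedZero F Q))
  have ha' : F.map a ≫ toLeftDerivedZero F Q = toLeftDerivedZero F P ≫ g := by
    rw [ha, Projective.factorThru_comp]
  -- Thus `a` carries the image of `P₁` into that of `Q₁`, and so descends to a morphism `X ⟶ Y` of
  -- cokernels.
  obtain ⟨b, hb⟩ := factors_of_map_comp_toLeftDerivedZero_eq_zero F hF hproj Q
    (P.complex.d 1 0 ≫ a) (by
      rw [F.map_comp, Category.assoc, ha', ← Category.assoc, map_d_toLeftDerivedZero, zero_comp])
  have h0 : P.complex.d 1 0 ≫ a ≫ Q.π.f 0 = 0 := by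
    rw [← Category.assoc, ← hb, Category.assoc, Q.complex_d_comp_π_f_zero, comp_zero]
  have hPπ : Epi (P.π.f 0) := inferInstance
  let f : X ⟶ Y := P.exact₀.desc (a ≫ Q.π.f 0) h0
  have hf : P.π.f 0 ≫ f = a ≫ Q.π.f 0 := P.exact₀.g_desc _ h0
  -- Naturality needs a full chain map, whereas `a` lives in degree `0` only. The chosen lift `φ`
  -- may differ from `a`, but only by a map through the differential, which `L₀F` does not see.
  let φ := ProjectiveResolution.lift f P Q
  have hφ : φ.f 0 ≫ Q.π.f 0 = P.π.f 0 ≫ f :=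
    ProjectiveResolution.lift_commutes_zero _ _ _
  let s := Q.exact₀.liftFromProjective (φ.f 0 - a) (by
    change (φ.f 0 - a) ≫ Q.π.f 0 = 0
    rw [Preadditive.sub_comp, hφ, hf, sub_self])
  have hs : s ≫ Q.complex.d 1 0 = φ.f 0 - a := Q.exact₀.liftFromProjective_comp _ _
  refine ⟨f, ?_⟩
  rw [← cancel_epi (toLeftDerivedZero F P), toLeftDerivedZero_naturality F f P Q φ hφ, ← ha',
    ← sub_eq_zero, ← Preadditive.sub_comp, ← F.map_sub, ← hs, F.map_comp, Category.assoc,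
    map_d_toLeftDerivedZero, comp_zero]

end LeftDerivedZero

/-! ## Representable functors are projective -/

/-- Epimorphisms between finitely presented functors are pointwise surjective, and a morphism out of
`(X, -)` is an element of the target at `X`; lifting the morphism amounts to lifting that element.
-/
instance {C : Type*} [Category.{u} C] [Abelian C] (X : Cᵒᵖ) : Projective ((yonedaFp C).obj X) where
  factors {E G} f e _ := by
    have := (isFinitelyPresented C).preservesEpimorphisms_ι_of_isNormalMonoCategory
    have : Epi e.hom := inferInstanceAs (Epi ((isFinitelyPresented C).ι.map e))
    have hs : Function.Surjective (e.hom.app X.unop) :=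
      (AddCommGrpCat.epi_iff_surjective _).1 inferInstance
    let p : preadditiveCoyoneda.obj X ⟶ G.obj := f.hom
    obtain ⟨x, hx⟩ := hs (p.app X.unop (𝟙 X.unop))
    have hadd : E.obj.Additive := ((isFinitelyPresented_iff _).1 E.property).1
    refine ⟨ObjectProperty.homMk
      { app A := AddCommGrpCat.ofHom (X := (X.unop ⟶ A)) (Y := E.obj.obj A)
          { toFun := fun g => E.obj.map g x
            map_zero' := by simp
            map_add' := by simp }
        naturality A B k := by
          ext g
          exact (map_comp_apply' E.obj (g : X.unop ⟶ A) k x).symm }, ?_⟩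
    ext A g
    have h₁ : p.app A (𝟙 X.unop ≫ (g : X.unop ⟶ A) :) = G.obj.map g (p.app _ (𝟙 X.unop)) :=
      NatTrans.naturality_apply p (g : X.unop ⟶ A) (𝟙 X.unop)
    have h₂ : p.app A (𝟙 X.unop ≫ (g : X.unop ⟶ A) :) = f.hom.app A g :=
      congrArg (p.app A) (Category.id_comp (g : X.unop ⟶ A))
    exact (NatTrans.naturality_apply e.hom (g : X.unop ⟶ A) x).trans
      ((congrArg (G.obj.map (g : X.unop ⟶ A)) hx).trans (h₁.symm.trans h₂))

lemma bijective_map_yonedaFp {C : Type*} [Category.{u} C] [Abelian C] (X Y : Cᵒᵖ) :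
    Function.Bijective ((yonedaFp C).map : (X ⟶ Y) → _) := by
  refine ⟨fun f g h => preadditiveCoyoneda.map_injective (congrArg (·.hom) h), fun f => ?_⟩
  obtain ⟨g, hg⟩ := preadditiveCoyoneda.map_surjective f.hom
  exact ⟨g, ObjectProperty.hom_ext _ hg⟩

/-! ## Exactness of injective functors -/

section InjectiveFunctors

variable {C : Type*} [Category.{u} C] [Preadditive C]

/-- The additive functor represented by an object. -/
def coyonedaAdd (X : C) : C ⥤+ AddCommGrpCat.{u} :=
  ⟨preadditiveCoyoneda.obj (op X), inferInstanceAs (preadditiveCoyoneda.obj (op X)).Additive⟩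

/-- The morphism of representable functors induced by a morphism. -/
def coyonedaAddMap {X Y : C} (f : X ⟶ Y) : coyonedaAdd Y ⟶ coyonedaAdd X :=
  ObjectProperty.homMk (preadditiveCoyoneda.map f.op)

/-- The morphism from a representable functor which corresponds to an element. -/
def coyonedaAddDesc {X : C} {G : C ⥤+ AddCommGrpCat.{u}} (x : G.obj.obj X) :
    coyonedaAdd X ⟶ G :=
  have : G.obj.Additive := G.property
  ObjectProperty.homMk
    { app A := AddCommGrpCat.ofHom (X := (X ⟶ A)) (Y := G.obj.obj A)
        { toFun := fun g => G.obj.map g x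
          map_zero' := by simp
          map_add' := by simp }
      naturality A B k := by
        ext g
        exact (map_comp_apply' G.obj (g : X ⟶ A) k x).symm }

lemma app_eq_map_app_id {X : C} {G : C ⥤+ AddCommGrpCat.{u}} (α : coyonedaAdd X ⟶ G) {A : C}
    (g : X ⟶ A) : α.hom.app A g = G.obj.map g (α.hom.app X (𝟙 X)) :=
  (congrArg (α.hom.app A) (Category.id_comp g).symm).trans
    (NatTrans.naturality_apply α.hom g (𝟙 X))

/-- Let `d : W ⟶ X` be a morphism and let `I` be an injective additive functor. If `x ∈ I(X)` is
killed by all morphisms `g` with `d ≫ g = 0`, then `x` lies in the image of `I(W) → I(X)`. -/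
lemma exists_map_eq_of_injective {W X : C} (d : W ⟶ X) (I : C ⥤+ AddCommGrpCat.{u}) [Injective I]
    (x : I.obj.obj X) (h : ∀ (A : C) (g : X ⟶ A), d ≫ g = 0 → I.obj.map g x = 0) :
    ∃ z : I.obj.obj W, I.obj.map d z = x := by
  -- By Yoneda `x` is a morphism `(X,-) ⟶ I`, and the hypothesis says that it vanishes on the kernel
  -- of `(X,-) ⟶ (W,-)`. Injectivity of `I` then extends it over `(W,-)`; the value of the extension
  -- at `𝟙 W` is the preimage sought.
  let a : coyonedaAdd X ⟶ coyonedaAdd W := coyonedaAddMap d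
  let S := ShortComplex.mk (kernel.ι a) a (kernel.condition a)
  have hS : S.Exact := ShortComplex.exact_of_f_is_kernel _ (kernelIsKernel a)
  have h0 : kernel.ι a ≫ coyonedaAddDesc x = 0 := by
    ext A w
    refine h A ((kernel.ι a).hom.app A w) ?_
    exact ConcreteCategory.congr_hom
      (NatTrans.congr_app (congrArg (·.hom) (kernel.condition a)) A) w
  let t : coyonedaAdd W ⟶ I := hS.descToInjective (coyonedaAddDesc x) h0
  have ht : a ≫ t = coyonedaAddDesc x := hS.comp_descToInjective _ h0
  refine ⟨t.hom.app W (𝟙 W), ?_⟩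
  rw [← app_eq_map_app_id]
  have h₁ : t.hom.app X (d ≫ 𝟙 X :) = I.obj.map (𝟙 X) x :=
    ConcreteCategory.congr_hom (NatTrans.congr_app (congrArg (·.hom) ht) X) (𝟙 X)
  rw [Category.comp_id] at h₁
  exact h₁.trans (ConcreteCategory.congr_hom (I.obj.map_id X) x)

end InjectiveFunctors

/-! ## Injective functors on finitely presented modules -/

section Modules

variable {R : Type u} [Ring R]

lemma map_sum_apply (G : FpMod R ⥤+ AddCommGrpCat.{u}) {X Y : FpMod R} {T : Type*} (s : Finset T)
    (f : T → (X ⟶ Y)) (x : G.obj.obj X) :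
    G.obj.map (∑ i ∈ s, f i) x = ∑ i ∈ s, G.obj.map (f i) x :=
  map_sum ((coyonedaAddDesc x).hom.app Y).hom f s

/-- The morphism of finitely presented modules given by a linear map. -/
def fpHom {X Y : FpMod R} (f : X.obj →ₗ[R] Y.obj) : X ⟶ Y :=
  (isFpModule R).homMk (ModuleCat.ofHom f)

lemma fp_hom_ext {X Y : FpMod R} {f g : X ⟶ Y} (h : ∀ x : X.obj, f.hom x = g.hom x) : f = g :=
  ObjectProperty.hom_ext _ (ModuleCat.hom_ext (LinearMap.ext h))

/-- The morphism from `R` which corresponds to an element. -/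
def fromRegular {M : FpMod R} (m : M.obj) : regular R ⟶ M :=
  fpHom (X := regular R) (LinearMap.toSpanSingleton R M.obj m)

lemma fromRegular_comp {M N : FpMod R} (m : M.obj) (f : M ⟶ N) :
    fromRegular m ≫ f = fromRegular (f.hom m) :=
  fp_hom_ext fun (x : R) => map_smul f.hom.hom x m

lemma eq_fromRegular {M : FpMod R} (f : regular R ⟶ M) : f = fromRegular (f.hom (1 : R)) :=
  fp_hom_ext fun (x : R) => by
    refine Eq.trans ?_ (map_smul f.hom.hom x (1 : R))
    exact congrArg f.hom.hom (mul_one x).symm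

/-! ### Finite free modules and coordinates -/

/-- A finite free module, as a finitely presented module. -/
def freeMod (R : Type u) [Ring R] (T : Type u) [Fintype T] : FpMod R :=
  ⟨ModuleCat.of R (T → R), inferInstanceAs (Module.FinitePresentation R (T → R))⟩

/-- The projections of a finite free module. -/
def freeProj {T : Type u} [Fintype T] (i : T) : freeMod R T ⟶ regular R :=
  fpHom (X := freeMod R T) (Y := regular R) (LinearMap.proj (R := R) (φ := fun _ : T => R) i)

/-- The inclusions of a finite free module. -/
def freeIncl {T : Type u} [Fintype T] [DecidableEq T] (i : T) : regular R ⟶ freeMod R T :=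
  fpHom (X := regular R) (Y := freeMod R T) (LinearMap.single R (fun _ : T => R) i)

/-- The morphism from a free module given by a family of elements. -/
def freeDesc {T : Type u} [Fintype T] {M : FpMod R} (m : T → M.obj) : freeMod R T ⟶ M :=
  fpHom (X := freeMod R T) (Fintype.linearCombination R m)

lemma freeIncl_freeProj {T : Type u} [Fintype T] [DecidableEq T] (i : T) :
    freeIncl (R := R) i ≫ freeProj i = 𝟙 _ :=
  fp_hom_ext fun (x : R) => Pi.single_eq_same (M := fun _ => R) i x

lemma freeIncl_freeProj_ne {T : Type u} [Fintype T] [DecidableEq T] {i j : T} (h : j ≠ i) :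
    freeIncl (R := R) i ≫ freeProj j = 0 :=
  fp_hom_ext fun (x : R) => Pi.single_eq_of_ne (M := fun _ => R) h x

lemma freeIncl_freeDesc {T : Type u} [Fintype T] [DecidableEq T] {M : FpMod R} (m : T → M.obj)
    (i : T) : freeIncl i ≫ freeDesc m = fromRegular (m i) :=
  fp_hom_ext fun (x : R) => Fintype.linearCombination_apply_single R m i x

lemma free_hom_ext {T : Type u} [Fintype T] [DecidableEq T] {M : FpMod R}
    {f g : freeMod R T ⟶ M} (h : ∀ i, freeIncl i ≫ f = freeIncl i ≫ g) : f = g := by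
  refine ObjectProperty.hom_ext _ (ModuleCat.hom_ext ?_)
  refine LinearMap.pi_ext (M := M.obj) fun i x => ?_
  exact ConcreteCategory.congr_hom (congrArg (·.hom) (h i)) x

lemma freeIncl_comp_sum {T : Type u} [Fintype T] [DecidableEq T] {M : FpMod R}
    (f : T → (regular R ⟶ M)) (j : T) : freeIncl j ≫ ∑ i : T, freeProj i ≫ f i = f j := by
  rw [Preadditive.comp_sum, Finset.sum_eq_single j]
  · rw [← Category.assoc, freeIncl_freeProj, Category.id_comp]
  · intro i _ hi
    rw [← Category.assoc, freeIncl_freeProj_ne hi, zero_comp]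
  · exact fun h => (h (Finset.mem_univ j)).elim

lemma sum_freeProj_comp {T : Type u} [Fintype T] [DecidableEq T] {M : FpMod R} (m : T → M.obj) :
    ∑ i : T, freeProj i ≫ fromRegular (m i) = freeDesc m :=
  free_hom_ext fun j => by rw [freeIncl_comp_sum, freeIncl_freeDesc]

lemma map_free_apply (G : FpMod R ⥤+ AddCommGrpCat.{u}) {T : Type u} [Fintype T] [DecidableEq T]
    {M : FpMod R} (q : freeMod R T ⟶ M) (y : G.obj.obj (freeMod R T)) :
    G.obj.map q y = ∑ i, G.obj.map (freeIncl i ≫ q) (G.obj.map (freeProj i) y) := by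
  have h : ∑ i : T, freeProj i ≫ freeIncl i ≫ q = q :=
    free_hom_ext fun j => freeIncl_comp_sum _ j
  conv_lhs => rw [← h, map_sum_apply]
  exact Finset.sum_congr rfl fun i _ => (map_comp_apply' G.obj _ _ y).symm

lemma map_freeDesc_apply {M : FpMod R} (G : FpMod R ⥤+ AddCommGrpCat.{u}) {T : Type u}
    [Fintype T] [DecidableEq T] (m : T → M.obj) (y : G.obj.obj (freeMod R T)) :
    G.obj.map (freeDesc m) y =
      ∑ i, G.obj.map (fromRegular (m i)) (G.obj.map (freeProj i) y) := by
  simp only [map_free_apply G (freeDesc m), freeIncl_freeDesc]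

lemma map_freeProj_sum (G : FpMod R ⥤+ AddCommGrpCat.{u}) {T : Type u} [Fintype T]
    [DecidableEq T] (x : T → G.obj.obj (regular R)) (i : T) :
    G.obj.map (freeProj i) (∑ j, G.obj.map (freeIncl j) (x j)) = x i := by
  have : G.obj.Additive := G.property
  rw [map_sum, Finset.sum_eq_single i]
  · rw [map_comp_apply', freeIncl_freeProj, G.obj.map_id]
    rfl
  · intro j _ hj
    rw [map_comp_apply', freeIncl_freeProj_ne hj.symm, Functor.map_zero]
    rfl
  · exact fun h => (h (Finset.mem_univ i)).elim

/-! ### Right exactness of injective functors -/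

lemma exists_comp_eq {W X M A : FpMod R} (d : W ⟶ X) (p : X ⟶ M)
    (hp : Function.Surjective p.hom)
    (hd : ∀ x : X.obj, p.hom x = 0 → ∃ w : W.obj, d.hom w = x) (g : X ⟶ A) (hg : d ≫ g = 0) :
    ∃ h : M ⟶ A, p ≫ h = g := by
  have hker : LinearMap.ker p.hom.hom ≤ LinearMap.ker g.hom.hom := fun x hx => by
    obtain ⟨w, rfl⟩ := hd x hx
    exact ConcreteCategory.congr_hom (congrArg (·.hom) hg) w
  let e := p.hom.hom.quotKerEquivOfSurjective hp
  refine ⟨fpHom (((LinearMap.ker p.hom.hom).liftQ g.hom.hom hker).comp e.symm.toLinearMap),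
    fp_hom_ext fun x => ?_⟩
  have h : e.symm (p.hom.hom x) = Submodule.Quotient.mk x :=
    e.symm_apply_eq.2 rfl
  exact (congrArg ((LinearMap.ker p.hom.hom).liftQ g.hom.hom hker) h).trans
    (Submodule.liftQ_apply _ _ x)

/-- Only `g = 0` satisfies `p ≫ g = 0`, so the criterion of `exists_map_eq_of_injective` holds for
every element. -/
lemma map_surjective_of_injective (I : FpMod R ⥤+ AddCommGrpCat.{u}) [Injective I]
    {X M : FpMod R} (p : X ⟶ M) (hp : Function.Surjective p.hom) :
    Function.Surjective (I.obj.map p) := fun x => by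
  have : I.obj.Additive := I.property
  refine exists_map_eq_of_injective p I x fun A g hg => ?_
  obtain rfl : g = 0 := fp_hom_ext fun m => by
    obtain ⟨x, rfl⟩ := hp m
    exact ConcreteCategory.congr_hom (congrArg (·.hom) hg) x
  rw [Functor.map_zero]
  rfl

/-- A morphism killed by `d` factors through `p`, and `p` already kills `x`. -/
lemma exists_map_eq_of_map_eq_zero (I : FpMod R ⥤+ AddCommGrpCat.{u}) [Injective I]
    {W X M : FpMod R} (d : W ⟶ X) (p : X ⟶ M) (hp : Function.Surjective p.hom)
    (hd : ∀ x : X.obj, p.hom x = 0 → ∃ w : W.obj, d.hom w = x) (x : I.obj.obj X)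
    (hx : I.obj.map p x = 0) : ∃ w, I.obj.map d w = x := by
  refine exists_map_eq_of_injective d I x fun A g hg => ?_
  obtain ⟨h, rfl⟩ := exists_comp_eq d p hp hd g hg
  rw [← map_comp_apply', hx, map_zero]

lemma range_freeDesc {T : Type u} [Fintype T] {M : FpMod R} (m : T → M.obj) :
    LinearMap.range (freeDesc m).hom.hom = Submodule.span R (Set.range m) :=
  Fintype.range_linearCombination R m

lemma exists_finset_span_eq_top (M : FpMod R) :
    ∃ s : Finset M.obj, Submodule.span R (s : Set M.obj) = ⊤ := by
  have : Module.FinitePresentation R M.obj := M.property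
  exact (inferInstance : Module.Finite R M.obj).fg_top

lemma freeDesc_surjective {M : FpMod R} {s : Finset M.obj}
    (hs : Submodule.span R (s : Set M.obj) = ⊤) :
    Function.Surjective (freeDesc (Subtype.val : s → M.obj)).hom := by
  refine LinearMap.range_eq_top.1 ((range_freeDesc _).trans ?_)
  rw [← hs]
  exact congrArg _ Subtype.range_coe

/-! ### Generators and relations for the values of a functor -/

variable (G : FpMod R ⥤+ AddCommGrpCat.{u})

/-- The additive map `⨁_{m ∈ M} G(R) → G(M)` whose component at `m` is induced by the
morphism `R ⟶ M` which corresponds to `m`. -/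
def sumMap (M : FpMod R) : (M.obj →₀ G.obj.obj (regular R)) →+ G.obj.obj M :=
  Finsupp.liftAddHom fun m => (G.obj.map (fromRegular m)).hom

lemma sumMap_apply (M : FpMod R) (t : M.obj →₀ G.obj.obj (regular R)) :
    sumMap G M t = t.sum fun m x => G.obj.map (fromRegular m) x :=
  Finsupp.liftAddHom_apply _ _

lemma sumMap_single {M : FpMod R} (m : M.obj) (x : G.obj.obj (regular R)) :
    sumMap G M (Finsupp.single m x) = G.obj.map (fromRegular m) x :=
  Finsupp.liftAddHom_apply_single _ _ _

/-- A finite generating set gives a surjection `R^s ⟶ M`, which `I` preserves, and an element of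
`I(R^s)` is determined by its coordinates in `I(R)`. -/
lemma sumMap_surjective (I : FpMod R ⥤+ AddCommGrpCat.{u}) [Injective I] (M : FpMod R) :
    Function.Surjective (sumMap I M) := fun x => by
  classical
  obtain ⟨s, hs⟩ := exists_finset_span_eq_top M
  obtain ⟨y, rfl⟩ := map_surjective_of_injective I _ (freeDesc_surjective hs) x
  refine ⟨∑ i : s, Finsupp.single i.1 (I.obj.map (freeProj i) y), ?_⟩
  rw [map_sum, map_freeDesc_apply]
  exact Finset.sum_congr rfl fun i _ => sumMap_single I _ _

variable {I J : FpMod R ⥤+ AddCommGrpCat.{u}} [Injective I]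

/-- An additive map `I(R) → J(R)` which commutes with all endomorphisms of `R` respects the
relations between the images of `I(R)` in `I(M)`. -/
lemma sumMap_mapRange_eq_zero (f : I.obj.obj (regular R) →+ J.obj.obj (regular R))
    (hf : ∀ (u : regular R ⟶ regular R) x, f (I.obj.map u x) = J.obj.map u (f x)) (M : FpMod R)
    (t : M.obj →₀ I.obj.obj (regular R)) (ht : sumMap I M t = 0) :
    sumMap J M (Finsupp.mapRange.addMonoidHom f t) = 0 := by
  classical
  have : Module.FinitePresentation R M.obj := M.property
  obtain ⟨s₀, hs₀⟩ := exists_finset_span_eq_top M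
  -- Adding the support of `t` to the generators makes `t` a family of coordinates on `R^s`.
  let s : Finset M.obj := s₀ ∪ t.support
  have hs : Submodule.span R (s : Set M.obj) = ⊤ := by
    refine top_le_iff.1 (hs₀.symm.le.trans (Submodule.span_mono ?_))
    exact_mod_cast Finset.subset_union_left
  let p := freeDesc (Subtype.val : s → M.obj)
  have : Module.Finite R (freeMod R s).obj := inferInstanceAs (Module.Finite R (s → R))
  have hp : Function.Surjective p.hom := freeDesc_surjective hs
  obtain ⟨k, hk⟩ := Module.FinitePresentation.fg_ker p.hom.hom hp
  let d : freeMod R k ⟶ freeMod R s :=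
    freeDesc (M := freeMod R s) (Subtype.val : k → (s → R))
  have hd (x : (freeMod R s).obj) : p.hom x = 0 ↔ ∃ w : (freeMod R k).obj, d.hom w = x := by
    have h : LinearMap.range d.hom.hom = LinearMap.ker p.hom.hom := by
      refine (range_freeDesc _).trans (Eq.trans ?_ hk)
      exact congrArg _ Subtype.range_coe
    exact (SetLike.ext_iff.1 h x).symm
  let y : I.obj.obj (freeMod R s) := ∑ i : s, I.obj.map (freeIncl i) (t i.1)
  have hy (i : s) : I.obj.map (freeProj i) y = t i.1 :=
    map_freeProj_sum I (fun i : s => t i.1) i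
  have sum_eq (G : FpMod R ⥤+ AddCommGrpCat.{u}) (t' : M.obj →₀ G.obj.obj (regular R))
      (h : t'.support ⊆ s) : sumMap G M t' = ∑ i : s, G.obj.map (fromRegular i.1) (t' i.1) := by
    rw [sumMap_apply, Finsupp.sum_of_support_subset _ h _ (by simp), ← Finset.sum_coe_sort]
  have hy0 : I.obj.map p y = 0 := by
    rw [map_freeDesc_apply, ← ht, sum_eq I t Finset.subset_union_right]
    exact Finset.sum_congr rfl fun i _ => by rw [hy]
  -- Right exactness of `I` along `R^k ⟶ R^s ⟶ M ⟶ 0` shows that the relation `t` comes from the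
  -- relations of `M`.
  obtain ⟨z, hz⟩ := exists_map_eq_of_map_eq_zero I d p hp (fun x hx => (hd x).1 hx) y hy0
  have hdp : d ≫ p = 0 := fp_hom_ext fun w => (hd _).2 ⟨w, rfl⟩
  have ht' (i : s) : t i.1 = ∑ j : k, I.obj.map (freeIncl j ≫ d ≫ freeProj i)
      (I.obj.map (freeProj j) z) := by
    rw [← hy, ← hz, map_comp_apply', map_free_apply]
  have hsupp : (Finsupp.mapRange.addMonoidHom f t).support ⊆ s :=
    (Finsupp.support_mapRange (hf := map_zero f)).trans Finset.subset_union_right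
  rw [sum_eq J _ hsupp]
  -- The entries of the matrix of `d` are endomorphisms of `R`, so `f` commutes with them. After
  -- exchanging the sums they reassemble to `d ≫ p = 0`, to which `J` is applied; additivity of `J`
  -- suffices.
  calc
    _ = ∑ i : s, ∑ j : k, J.obj.map ((freeIncl j ≫ d) ≫ freeProj i ≫ fromRegular i.1)
        (f (I.obj.map (freeProj j) z)) := by
      refine Finset.sum_congr rfl fun i _ => ?_
      change J.obj.map (fromRegular i.1) (f (t i.1)) = _
      rw [ht', map_sum, map_sum]
      refine Finset.sum_congr rfl fun j _ => ?_
      rw [hf, map_comp_apply', Category.assoc, Category.assoc, Category.assoc]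
    _ = ∑ j : k, J.obj.map ((freeIncl j ≫ d) ≫ p) (f (I.obj.map (freeProj j) z)) := by
      rw [Finset.sum_comm]
      refine Finset.sum_congr rfl fun j _ => ?_
      rw [← map_sum_apply, ← Preadditive.comp_sum, sum_freeProj_comp]
    _ = 0 := by
      have : J.obj.Additive := J.property
      refine Finset.sum_eq_zero fun j _ => ?_
      rw [Category.assoc, hdp, comp_zero, Functor.map_zero]
      rfl

/-! ### Full faithfulness of evaluation at `R` on injective functors -/

variable (I J)

lemma evR_map_injective : Function.Injective ((evR R).map : (I ⟶ J) → _) := fun α β h => by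
  ext M x
  obtain ⟨t, rfl⟩ := sumMap_surjective I M x
  have h' (x : I.obj.obj (regular R)) :
      α.hom.app (regular R) x = β.hom.app (regular R) x :=
    ConcreteCategory.congr_hom h x
  have (γ : I ⟶ J) (m : M.obj) (x : I.obj.obj (regular R)) :
      γ.hom.app M (sumMap I M (Finsupp.single m x)) =
        J.obj.map (fromRegular m) (γ.hom.app (regular R) x) := by
    rw [sumMap_single]
    exact NatTrans.naturality_apply γ.hom (fromRegular m) x
  refine DFunLike.congr_fun (f := (α.hom.app M).hom.comp (sumMap I M))
    (g := (β.hom.app M).hom.comp (sumMap I M)) (Finsupp.addHom_ext fun m x => ?_) t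
  exact (this α m x).trans ((congrArg _ (h' x)).trans (this β m x).symm)

lemma evR_map_surjective : Function.Surjective ((evR R).map : (I ⟶ J) → _) := fun g => by
  let f : I.obj.obj (regular R) →+ J.obj.obj (regular R) := g.hom.toAddMonoidHom
  have hf (u : regular R ⟶ regular R) (x : I.obj.obj (regular R)) :
      f (I.obj.map u x) = J.obj.map u (f x) := by
    -- Every endomorphism of the left module `R` is right multiplication by the image of `1`, so
    -- linearity of `g` covers them all.
    rw [eq_fromRegular u]
    let r : R := u.hom (1 : R)
    exact g.hom.map_smul (MulOpposite.op r) x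
  -- The component at `M` is `f` applied to each summand `I(R)`, descended along the surjection
  -- `sumMap I M`.
  let F (M : FpMod R) : I.obj.obj M →+ J.obj.obj M :=
    AddMonoidHom.liftOfSurjective (sumMap I M) (sumMap_surjective I M)
      ⟨(sumMap J M).comp (Finsupp.mapRange.addMonoidHom f),
        fun t ht => sumMap_mapRange_eq_zero f hf M t ht⟩
  have hF (M : FpMod R) (m : M.obj) (x : I.obj.obj (regular R)) :
      F M (I.obj.map (fromRegular m) x) = J.obj.map (fromRegular m) (f x) := by
    rw [← sumMap_single]
    refine (AddMonoidHom.liftOfRightInverse_comp_apply _ _ _ _ _).trans ?_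
    refine (congrArg (sumMap J M) (Finsupp.mapRange_single (hf := map_zero f))).trans ?_
    exact sumMap_single J m (f x)
  refine ⟨ObjectProperty.homMk
    { app M := AddCommGrpCat.ofHom (F M)
      naturality M N k := ?_ }, ?_⟩
  · ext x
    obtain ⟨t, rfl⟩ := sumMap_surjective I M x
    refine DFunLike.congr_fun (f := ((F N).comp (I.obj.map k).hom).comp (sumMap I M))
      (g := ((J.obj.map k).hom.comp (F M)).comp (sumMap I M))
      (Finsupp.addHom_ext fun m x => ?_) t
    change F N (I.obj.map k (sumMap I M (Finsupp.single m x))) =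
      J.obj.map k (F M (sumMap I M (Finsupp.single m x)))
    rw [sumMap_single, map_comp_apply', fromRegular_comp, hF, hF, map_comp_apply',
      fromRegular_comp]
  · refine ModuleCat.hom_ext (LinearMap.ext fun x => ?_)
    -- At `M = R`, the generator attached to `1` identifies the new component with `f`.
    have h1 : fromRegular (M := regular R) (1 : R) = 𝟙 (regular R) :=
      (eq_fromRegular (𝟙 (regular R))).symm
    have h2 := hF (regular R) (1 : R) x
    rw [h1, I.obj.map_id, J.obj.map_id] at h2
    exact h2

end Modules

/-- Projectives of the opposite category are injective functors. A morphism `P ⟶ Q` is a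
transformation `Q.unop ⟶ P.unop`, which is why the roles are exchanged below. -/
lemma bijective_map_yonedaEv {R : Type u} [Ring R] (P Q : (FpMod R ⥤+ AddCommGrpCat.{u})ᵒᵖ)
    [Projective P] [Projective Q] : Function.Bijective ((yonedaEv R).map : (P ⟶ Q) → _) := by
  have : Injective P.unop := inferInstance
  have : Injective Q.unop := inferInstance
  have hev : Function.Bijective ((evR R).op.map : (P ⟶ Q) → _) :=
    (opEquiv _ _).symm.bijective.comp
      (Function.Bijective.comp ⟨evR_map_injective Q.unop P.unop, evR_map_surjective Q.unop P.unop⟩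
        (opEquiv P Q).bijective)
  exact (bijective_map_yonedaFp _ _).comp hev

end AGJ
end

theorem mainTheorem11 (R : Type u) [Ring R] :
    (AGJ.DL R).Full ∧ (AGJ.DL R).Faithful :=
  have hproj (P : (AGJ.FpMod R ⥤+ AddCommGrpCat.{u})ᵒᵖ) [Projective P] :
      Projective ((AGJ.yonedaEv R).obj P) :=
    inferInstanceAs (Projective ((AGJ.yonedaFp (AGJ.RMod R)).obj ((AGJ.evR R).op.obj P)))
  ⟨AGJ.full_leftDerived_zero (AGJ.yonedaEv R) (fun P Q => AGJ.bijective_map_yonedaEv P Q) hproj,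
    AGJ.faithful_leftDerived_zero (AGJ.yonedaEv R) (fun P Q => AGJ.bijective_map_yonedaEv P Q) hproj⟩
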